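/- **Setting.** Let $G=(V,A)$ be a finite nonempty digraph without self-loops and parallel arcs that is strongly connected. Vertices are parties, and the arc $(u,v)$ stands for an asset to be transferred from its owner $u$ to $v$. Time is discrete, $t=0,1,2,\dots$ **HTLC-based protocols.** In each time step, each party $v$ can do any number of the following. (1) Create a secret/hashlock pair $(s_v,h_v)$; each party can create only one. (2) For an arc $(v,w)\in A$, create the contract $(v,w)$, at most once, with a timeout $\tau_{vw}\in\mathbb N$ and a hashlock $h_x$ known to $v$ of some party $x$ that has created its pair; the contract is then *protected by* $x$. (3) If the contract $(u,v)$ exists, the time $t$ satisfies $t\le\tau_{uv}$, and $v$ knows the secret $s_x$ of the party $x$ protecting it, claim the asset $(u,v)$; then $u$ learns $s_x$. (4) Send hashlock values that it knows to other parties. A party learns secrets only by creating them or as the seller of a claimed contract; it learns hashlock values by creating them, by receiving them, or from its incoming contracts. The effects of a step become visible to other parties in the next step. An *HTLC-based protocol* $\mathbb P$ prescribes to each party, at each time, its actions as an arbitrary function of what it has seen so far: whether it created its own pair, the incoming and outgoing contracts, which of these have been claimed (and so the secrets obtained), and the hashlock values received. An asset is *transferred* in an execution if it is claimed at some time; otherwise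 it stays with its owner. In an execution in which the parties of a set $C$ deviate from $\mathbb P$, these take arbitrary permitted actions and share all secrets and hashlock values that they know. **Outcomes and preferences.** For a set $C$ of parties, let $A^{in}_C$ and $A^{out}_C$ be the sets of arcs entering and leaving $C$. An *outcome* of $C$ is a pair $\langle\omega^{in}|\omega^{out}\rangle$ with $\omega^{in}\subseteq A^{in}_C$ (assets acquired) and $\omega^{out}\subseteq A^{out}_C$ (assets relinquished). It is *acceptable* if $\omega^{in}=A^{in}_C$ or $\omega^{out}=\emptyset$. Put $\mathrm{Deal}=\langle A^{in}_C|A^{out}_C\rangle$ and $\mathrm{NoDeal}=\langle\emptyset|\emptyset\rangle$. The outcomes of a party $v$ are those of $\{v\}$. A *preference relation* of $C$ is a partial order on its outcomes in which acquiring more and relinquishing less is at least as good, every unacceptable outcome is worse than NoDeal, and Deal is better than NoDeal (if these two differ). Let a preference relation be given for each set of parties. **Atomicity.** $\mathbb P$ is *live* if all assets are transferred when all parties follow $\mathbb P$; it is *safe* if each party following $\mathbb P$ ends up in an acceptable outcome whatever the other parties do; it has the *strong Nash equilibrium property* if, for every set $C$ of parties, when all parties outside $C$ follow $\mathbb P$,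 the parties in $C$ cannot by deviating reach an outcome of $C$ that is preferred to the outcome of $C$ in the execution where all follow $\mathbb P$. $\mathbb P$ is *atomic* if it has all three properties. **Reuniclus digraphs.** A vertex of a digraph is a *bottleneck vertex* if it belongs to every cycle. $G$ is a *reuniclus digraph* if there are distinct vertices $b_1,\dots,b_p$ $(p\ge 1)$ of $G$, induced subgraphs $G_1,\dots,G_p$ of $G$ whose union (of vertices and of arcs) is $G$, and a rooted tree $\mathcal K$ with node set $\{b_1,\dots,b_p\}$, such that - (rg1) each $G_j$ is strongly connected, $b_j\in G_j$, and $b_j$ is a bottleneck vertex of $G_j$; - (rg2) each vertex other than $b_1,\dots,b_p$ belongs to exactly one $G_j$; the root $b_j$ of $\mathcal K$ belongs to $G_j$ only; and each non-root $b_j$ with parent $b_i$ in $\mathcal K$ belongs to $G_j$ and $G_i$ and to no other $G_k$. **Lemma.** If $G$ has an atomic HTLC-based protocol, then $G$ is a reuniclus digraph. -/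

import Mathlib

namespace AssetSwap

/-! ### Digraphs -/

/-- Every vertex can be reached from every vertex. -/
def StronglyConnected {V : Type*} (G : Digraph V) : Prop :=
  ∀ u v : V, Relation.ReflTransGen G.Adj u v

/-- The subgraph of `G` induced by the vertex set `S`. -/
def induced {V : Type*} (G : Digraph V) (S : Set V) : Digraph S where
  Adj u v := G.Adj u v

/-- `p` is the vertex sequence of a cycle of `G`: it has at least one arc, consecutive vertices
are joined by arcs, the first vertex equals the last one, and no arc is repeated. -/
def IsCycle {V : Type*} (G : Digraph V) (p : List V) : Prop :=
  2 ≤ p.length ∧ p.IsChain G.Adj ∧ p.head? = p.getLast? ∧ (p.zip p.tail).Nodup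

/-- A bottleneck vertex belongs to each cycle. -/
def IsBottleneckVertex {V : Type*} (G : Digraph V) (b : V) : Prop :=
  ∀ p : List V, IsCycle G p → b ∈ p

/-- A set `B` of vertices with a distinguished `root ∈ B` and a map `parent` (of which only the
values at the non-root elements of `B` matter) forms a rooted tree: parents of non-root nodes are
nodes, and every node reaches the root by passing to parents. -/
def IsRootedTree {V : Type*} (B : Set V) (root : V) (parent : V → V) : Prop :=
  root ∈ B ∧ (∀ b ∈ B, b ≠ root → parent b ∈ B) ∧ (∀ b ∈ B, ∃ n : ℕ, parent^[n] b = root)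

/-- Reuniclus digraphs: `G` is a union of induced bottleneck subgraphs `G_b` (on the vertex sets
`part b`), indexed by their designated bottleneck vertices `b ∈ B`, which are the nodes of a rooted
tree.  A vertex that is not designated lies in exactly one `G_b`; the designated vertex `b` lies
exactly in `G_b` and, if `b` is not the root, in `G_(parent b)`. -/
def IsReuniclus {V : Type*} (G : Digraph V) : Prop :=
  ∃ (B : Set V) (root : V) (parent : V → V) (part : V → Set V),
    IsRootedTree B root parent ∧
    (∀ v, ∃ b ∈ B, v ∈ part b) ∧
    (∀ u v, G.Adj u v → ∃ b ∈ B, u ∈ part b ∧ v ∈ part b) ∧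
    (∀ b ∈ B, StronglyConnected (induced G (part b)) ∧
      ∃ hb : b ∈ part b, IsBottleneckVertex (induced G (part b)) ⟨b, hb⟩) ∧
    (∀ u, u ∉ B → ∃! b, b ∈ B ∧ u ∈ part b) ∧
    (∀ b ∈ B, ∀ c ∈ B, b ∈ part c ↔ c = b ∨ (b ≠ root ∧ c = parent b))

/-! ### Outcomes and preferences -/

/-- Arcs entering the set `C` of parties. -/
def inArcs {V : Type*} (G : Digraph V) (C : Set V) : Set (V × V) :=
  {a | G.Adj a.1 a.2 ∧ a.1 ∉ C ∧ a.2 ∈ C}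

/-- Arcs leaving the set `C` of parties. -/
def outArcs {V : Type*} (G : Digraph V) (C : Set V) : Set (V × V) :=
  {a | G.Adj a.1 a.2 ∧ a.1 ∈ C ∧ a.2 ∉ C}

/-- An outcome of a set `C` of parties: the assets acquired and the assets relinquished. The
outcomes of a single party `v` are those of `{v}`. -/
@[ext]
structure Outcome {V : Type*} (G : Digraph V) (C : Set V) where
  acquired : Set (V × V)
  relinquished : Set (V × V)
  acquired_subset : acquired ⊆ inArcs G C
  relinquished_subset : relinquished ⊆ outArcs G C

/-- All transfers involving `C` are completed. -/
def Outcome.deal {V : Type*} (G : Digraph V) (C : Set V) : Outcome G C where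
  acquired := inArcs G C
  relinquished := outArcs G C
  acquired_subset := subset_rfl
  relinquished_subset := subset_rfl

/-- No transfer involving `C` is completed. -/
def Outcome.noDeal {V : Type*} (G : Digraph V) (C : Set V) : Outcome G C where
  acquired := ∅
  relinquished := ∅
  acquired_subset := Set.empty_subset _
  relinquished_subset := Set.empty_subset _

/-- All incoming assets are acquired, or all own assets are retained. Outcomes that are not
acceptable are called underwater. -/
def Outcome.Acceptable {V : Type*} {G : Digraph V} {C : Set V} (o : Outcome G C) : Prop :=
  o.acquired = inArcs G C ∨ o.relinquished = ∅

/-- A preference relation on the outcomes of `C`; `a ≤ b` means that `b` is at least as good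
as `a`. (The proviso in `noDeal_lt_deal` matters only if no arc enters or leaves `C`.) -/
structure Preference {V : Type*} (G : Digraph V) (C : Set V) extends
    PartialOrder (Outcome G C) where
  mono : ∀ a b : Outcome G C,
    a.acquired ⊆ b.acquired → b.relinquished ⊆ a.relinquished → le a b
  underwater_lt_noDeal : ∀ a : Outcome G C, ¬ a.Acceptable → lt a (Outcome.noDeal G C)
  noDeal_lt_deal : Outcome.deal G C ≠ Outcome.noDeal G C →
    lt (Outcome.noDeal G C) (Outcome.deal G C)

/-! ### HTLC-based protocols

Secrets and hashlocks are symbolic: each party `x` can create one pair, so the pair of `x`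
is referred to by `x` itself. -/

/-- The data of a hash time-lock contract: the party whose hashlock protects it, and its timeout. -/
structure Contract (V : Type*) where
  hashlock : V
  timeout : ℕ

/-- What a party asks to do in one time step. -/
structure Action (V : Type*) where
  /-- create the own secret/hashlock pair -/
  createSecret : Prop
  /-- `create w` is the contract to be created for the asset to be transferred to `w`, if any -/
  create : V → Option (Contract V)
  /-- `claim u`: claim the asset of `u` -/
  claim : V → Prop
  /-- `tell w x`: send the hashlock value of `x` to `w` -/
  tell : V → V → Prop

/-- The action of a party that does nothing. -/
def Action.idle {V : Type*} : Action V where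
  createSecret := False
  create _ := none
  claim _ := False
  tell _ _ := False

/-- A global state of an execution. -/
structure State (V : Type*) where
  /-- `x` has created its secret/hashlock pair -/
  secret : V → Prop
  /-- `contract u w` is the contract on the arc `(u, w)`, if already created -/
  contract : V → V → Option (Contract V)
  /-- the asset `(u, w)` was successfully claimed by `w` -/
  claimed : V → V → Prop
  /-- `told u w x`: `u` has sent the hashlock value of `x` to `w` -/
  told : V → V → V → Prop

/-- The initial state. -/
def State.init {V : Type*} : State V where
  secret _ := False
  contract _ _ := none
  claimed _ _ := False
  told _ _ _ := False

/-- `v` itself knows the secret of `x`: `v` has created it, or received it as the seller of a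
claimed contract. -/
def State.KnowsSecret {V : Type*} (s : State V) (v x : V) : Prop :=
  (v = x ∧ s.secret x) ∨
    ∃ w c, s.contract v w = some c ∧ s.claimed v w ∧ c.hashlock = x

/-- `v` itself knows the hashlock of `x`: `v` has created it, was sent it, or has read it in an
incoming contract. -/
def State.KnowsHashlock {V : Type*} (s : State V) (v x : V) : Prop :=
  (v = x ∧ s.secret x) ∨ (∃ u, s.told u v x) ∨
    ∃ u c, s.contract u v = some c ∧ c.hashlock = x

/-- The parties that pool their knowledge with `v`, if the parties in `C` collude. -/
def team {V : Type*} (C : Set V) (v : V) : Set V :=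
  {w | w = v ∨ (v ∈ C ∧ w ∈ C)}

open Classical in
/-- The effect of one time step, executed at time `t`, if party `v` asks for `act v` and the
parties in `C` collude. Actions that are not permitted have no effect. Contracts created and assets
claimed in this step are seen by other parties only in the next one. -/
noncomputable def step {V : Type*} (G : Digraph V) (C : Set V) (t : ℕ) (act : V → Action V)
    (s : State V) : State V :=
  let s₁ : State V := { s with secret := fun v => s.secret v ∨ (act v).createSecret }
  { secret := s₁.secret
    contract := fun u w =>
      (s.contract u w).or
        (((act u).create w).filter fun c =>
          decide (G.Adj u w ∧ ∃ m ∈ team C u, s₁.KnowsHashlock m c.hashlock))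
    claimed := fun u w => s.claimed u w ∨
      ((act w).claim u ∧ ∃ c, s.contract u w = some c ∧ t ≤ c.timeout ∧
        ∃ m ∈ team C w, s.KnowsSecret m c.hashlock)
    told := fun u w x => s.told u w x ∨
      ((act u).tell w x ∧ ∃ m ∈ team C u, s₁.KnowsHashlock m x) }

/-- What a party can see in a state: whether it has created its secret, its incoming and outgoing
contracts, which of these were claimed (so it sees the secrets it got as a seller), and the hashlock
values it was sent, with their senders. -/
structure View (V : Type*) where
  secret : Prop
  incoming : V → Option (Contract V)
  incomingClaimed : V → Prop
  outgoing : V → Option (Contract V)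
  outgoingClaimed : V → Prop
  told : V → V → Prop

/-- The view of party `v` in state `s`. -/
def State.view {V : Type*} (s : State V) (v : V) : View V where
  secret := s.secret v
  incoming u := s.contract u v
  incomingClaimed u := s.claimed u v
  outgoing w := s.contract v w
  outgoingClaimed w := s.claimed v w
  told u x := s.told u v x

/-- An HTLC-based protocol tells each party `v` at each time `t` what to do, as an arbitrary
function of all that `v` has seen at the times `t, t - 1, …, 0` (the list of its `t + 1` views, the
latest first). -/
abbrev Protocol (V : Type*) := V → List (View V) → Action V

/-- The state at time `t` and the list of the views of each party up to that time, in the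
execution of `P` where the parties outside `C` follow `P` and those in `C` act as prescribed by
`dev`. As `P` is deterministic, letting `dev` range over all sequences of actions covers all adaptive
behavior of the deviating parties. -/
noncomputable def run {V : Type*} (G : Digraph V) (P : Protocol V) (C : Set V)
    (dev : ℕ → V → Action V) : ℕ → State V × (V → List (View V))
  | 0 => (State.init, fun v => [State.init.view v])
  | t + 1 =>
    open Classical in
    let r := run G P C dev t
    let s := step G C t (fun v => if v ∈ C then dev t v else P v (r.2 v)) r.1
    (s, fun v => s.view v :: r.2 v)

/-- The assets transferred in the end: those that are claimed at some time. The other ones are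
with their original owners. -/
def transferred {V : Type*} (G : Digraph V) (P : Protocol V) (C : Set V)
    (dev : ℕ → V → Action V) : Set (V × V) :=
  {a | ∃ t, (run G P C dev t).1.claimed a.1 a.2}

/-- The assets transferred if all parties follow `P`. -/
def conforming {V : Type*} (G : Digraph V) (P : Protocol V) : Set (V × V) :=
  transferred G P ∅ fun _ _ => Action.idle

/-- The outcome of `D` if `T` is the set of transferred assets. -/
def outcome {V : Type*} (G : Digraph V) (T : Set (V × V)) (D : Set V) : Outcome G D where
  acquired := T ∩ inArcs G D
  relinquished := T ∩ outArcs G D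
  acquired_subset := Set.inter_subset_right
  relinquished_subset := Set.inter_subset_right

/-- If all parties follow the protocol then all assets are transferred. -/
def IsLive {V : Type*} (G : Digraph V) (P : Protocol V) : Prop :=
  ∀ u v, G.Adj u v → (u, v) ∈ conforming G P

/-- Each honest party ends up with an acceptable outcome, whatever the other parties do. -/
def IsSafe {V : Type*} (G : Digraph V) (P : Protocol V) : Prop :=
  ∀ (C : Set V) (dev : ℕ → V → Action V), ∀ v ∉ C,
    (outcome G (transferred G P C dev) {v}).Acceptable

/-- No coalition can improve its outcome by deviating. -/
def IsStrongNash {V : Type*} (G : Digraph V) (pref : ∀ C : Set V, Preference G C)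
    (P : Protocol V) : Prop :=
  ∀ (C : Set V) (dev : ℕ → V → Action V),
    ¬ (pref C).lt (outcome G (conforming G P) C) (outcome G (transferred G P C dev) C)

/-- Atomic protocols. -/
def IsAtomic {V : Type*} (G : Digraph V) (pref : ∀ C : Set V, Preference G C)
    (P : Protocol V) : Prop :=
  IsLive G P ∧ IsSafe G P ∧ IsStrongNash G pref P

end AssetSwap

/-!
Label every arc of `G` by the party that protects its contract in the execution in which all parties
follow the atomic protocol.  Call an arc *foreign* if its label is not its seller.

* A foreign arc `(v, w)` is created only after all arcs entering `v`, since otherwise the other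
  parties could stop creating contracts and claim `(v, w)`, leaving `v` underwater.  This and
  the next use of safety rest on `exists_contract_of_exposed`.
* If `(v, w)` is foreign with label `y`, then the arcs entering `v` carry only the labels `y` and
  `v`, and `y` does occur (`label_in_of_foreign`).  Indeed, when all the arcs entering `v` can be
  claimed by `v`, then by the Nash property all the arcs leaving `v` exist already, as `v` could
  otherwise take everything and not create the missing contract (`exists_contract_of_nash`).  So if
  only `v` occurred as a label, then `v` would not create `(v, w)`.  And just before the first
  foreign arc leaving `v` is claimed, the other parties can choose to claim just one foreign arc
  leaving `v`, of any label they like; this one secret, and its own, must be enough for `v`.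
* If `(u, v)` is not protected by `v`, then `v` learns the secret from an arc leaving `v`, which
  has the same label.

These three properties give the reuniclus structure (`isReuniclus_of_label`).  By the first one,
creation times provide a height function that increases along foreign arcs, so each cycle has an arc
protected by its seller.  By the other two, the arcs at `v` carry at most one label other than `v`,
the parent of `v`; a vertex without such a label is its own parent.  Following foreign arcs of a
fixed label leads to that label, so heights increase from a vertex to its parent, and parents form a
forest.  The two labels available at the ends of an arc meet, so by strong connectivity the
forest is a tree.  The part of `b` consists of `b` and its children, and its arcs are those with
label `b`.
-/

namespace AssetSwap

variable {V : Type*}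

/-! ### Digraphs with labelled arcs -/

section Labels

open Relation

/-- In a labelling by protecting parties, `h` is a height function that increases along the arcs
which are not protected by their sellers, `relay` says that a buyer learns a foreign secret from an
arc with the same label, and `only` and `occurs` say that a foreign label of an arc leaving `v` is
the only foreign label of the arcs entering `v`, and is present there. -/
structure IsSwapLabeling (G : Digraph V) (label : V → V → V) (h : V → ℕ) : Prop where
  height_lt : ∀ v w, G.Adj v w → label v w ≠ v → h v < h w
  relay : ∀ u v, G.Adj u v → label u v ≠ v → ∃ w, G.Adj v w ∧ label v w = label u v
  occurs : ∀ v w, G.Adj v w → label v w ≠ v → ∃ u, G.Adj u v ∧ label u v = label v w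
  only : ∀ v w, G.Adj v w → label v w ≠ v →
    ∀ u, G.Adj u v → label u v = label v w ∨ label u v = v

open Classical in
/-- The label other than `v` of an arc entering `v`, or `v` itself if there is none. -/
noncomputable def parentOf (G : Digraph V) (label : V → V → V) (v : V) : V :=
  if h : ∃ u, G.Adj u v ∧ label u v ≠ v then label h.choose v else v

/-- The vertex `b` and its children. -/
def partOf (G : Digraph V) (label : V → V → V) (b : V) : Set V :=
  {v | v = b ∨ parentOf G label v = b}

variable {G : Digraph V} {label : V → V → V} {h : V → ℕ}

theorem exists_label_eq_parentOf {v : V} (hv : parentOf G label v ≠ v) :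
    ∃ u, G.Adj u v ∧ label u v = parentOf G label v := by
  unfold parentOf at hv ⊢
  split_ifs at hv ⊢ with h
  · exact ⟨_, h.choose_spec.1, rfl⟩
  · exact absurd rfl hv

namespace IsSwapLabeling

theorem label_in (H : IsSwapLabeling G label h) {u v : V} (huv : G.Adj u v) :
    label u v = v ∨ label u v = parentOf G label v := by
  by_cases hl : label u v = v
  · exact Or.inl hl
  right
  have hex : ∃ u, G.Adj u v ∧ label u v ≠ v := ⟨u, huv, hl⟩
  obtain ⟨w, hvw, hw⟩ := H.relay u v huv hl
  have h1 := H.only v w hvw (by rwa [hw]) _ hex.choose_spec.1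
  rw [parentOf, dif_pos hex, ← hw]
  exact (h1.resolve_right hex.choose_spec.2).symm

theorem label_out (H : IsSwapLabeling G label h) {v w : V} (hvw : G.Adj v w) :
    label v w = v ∨ label v w = parentOf G label v := by
  by_cases hl : label v w = v
  · exact Or.inl hl
  right
  obtain ⟨u, huv, hu⟩ := H.occurs v w hvw hl
  rw [← hu] at hl ⊢
  exact (H.label_in huv).resolve_left hl

theorem left_mem_partOf (H : IsSwapLabeling G label h) {u v : V} (huv : G.Adj u v) :
    u ∈ partOf G label (label u v) :=
  (H.label_out huv).imp Eq.symm Eq.symm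

theorem right_mem_partOf (H : IsSwapLabeling G label h) {u v : V} (huv : G.Adj u v) :
    v ∈ partOf G label (label u v) :=
  (H.label_in huv).imp Eq.symm Eq.symm

/-- A non-root vertex has an arc that carries the label of its parent and leads upwards within the
part of the parent. -/
theorem exists_adj_parentOf (H : IsSwapLabeling G label h) {v : V}
    (hv : parentOf G label v ≠ v) :
    ∃ w ∈ partOf G label (parentOf G label v), G.Adj v w ∧ h v < h w := by
  obtain ⟨u, huv, hu⟩ := exists_label_eq_parentOf hv
  obtain ⟨w, hvw, hw⟩ := H.relay u v huv (by rwa [hu])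
  rw [hu] at hw
  exact ⟨w, hw ▸ H.right_mem_partOf hvw, hvw, H.height_lt v w hvw (by rwa [hw])⟩

/-- Climbing along the arcs of `exists_adj_parentOf` must end, and can end only at `b`. -/
theorem reflTransGen_to [Finite V] (H : IsSwapLabeling G label h) {b : V}
    (hb : b ∈ partOf G label b) (v : partOf G label b) :
    ReflTransGen (induced G (partOf G label b)).Adj v ⟨b, hb⟩ ∧ h v ≤ h b := by
  obtain ⟨N, hN⟩ := (Set.finite_range h).bddAbove
  induction hk : N - h v using Nat.strong_induction_on generalizing v with
  | _ k ih =>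
    obtain ⟨v, hv⟩ := v
    by_cases hvb : v = b
    · subst hvb
      exact ⟨.refl, le_rfl⟩
    obtain rfl := hv.resolve_left hvb
    obtain ⟨w, hw, hvw, hlt⟩ := H.exists_adj_parentOf (Ne.symm hvb)
    have hwN : h w ≤ N := hN ⟨w, rfl⟩
    simp only at hk
    obtain ⟨h1, h2⟩ := ih _ (by simp only; omega) ⟨w, hw⟩ rfl
    exact ⟨h1.head (show (induced G _).Adj ⟨v, hv⟩ ⟨w, hw⟩ from hvw), hlt.le.trans h2⟩

theorem height_lt_parentOf [Finite V] (H : IsSwapLabeling G label h) {v : V}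
    (hv : parentOf G label v ≠ v) : h v < h (parentOf G label v) := by
  obtain ⟨w, hw, -, hlt⟩ := H.exists_adj_parentOf hv
  exact hlt.trans_le (H.reflTransGen_to (Or.inl rfl) ⟨w, hw⟩).2

/-- Backwards from `v`, there are arcs with label `b`, whose sources get lower and lower until `b`
is reached. -/
theorem reflTransGen_from (H : IsSwapLabeling G label h) {b : V}
    (hb : b ∈ partOf G label b) (v : partOf G label b) :
    ReflTransGen (induced G (partOf G label b)).Adj ⟨b, hb⟩ v := by
  induction hk : h v using Nat.strong_induction_on generalizing v with
  | _ k ih =>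
    obtain ⟨v, hv⟩ := v
    by_cases hvb : v = b
    · subst hvb
      exact .refl
    obtain rfl := hv.resolve_left hvb
    obtain ⟨u, huv, hu⟩ := exists_label_eq_parentOf (Ne.symm hvb)
    have hmem := hu ▸ H.left_mem_partOf huv
    by_cases hub : u = parentOf G label v
    · subst hub
      exact .single huv
    · have hlt := H.height_lt u v huv (by rw [hu]; exact Ne.symm hub)
      exact (ih _ (hk ▸ hlt) ⟨u, hmem⟩ rfl).tail huv

/-- A cycle of a part that avoids the designated vertex `b` has only foreign arcs, as they all
carry the label `b`; this is impossible, because the height would increase all along it. -/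
theorem isBottleneckVertex (H : IsSwapLabeling G label h) (hloop : ∀ v, ¬ G.Adj v v) {b : V}
    (hb : b ∈ partOf G label b) :
    IsBottleneckVertex (induced G (partOf G label b)) ⟨b, hb⟩ := by
  rintro p ⟨hlen, hchain, hends, -⟩
  by_contra hbp
  have hlt : p.IsChain fun x y : partOf G label b => h x < h y := by
    refine List.IsChain.imp_of_mem_imp (fun x y hx hy hxy => ?_) hchain
    have hxb : x.1 ≠ b := fun e => hbp (by rwa [← Subtype.ext (a1 := x) (a2 := ⟨b, hb⟩) e])
    have hyb : y.1 ≠ b := fun e => hbp (by rwa [← Subtype.ext (a1 := y) (a2 := ⟨b, hb⟩) e])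
    have hadj : G.Adj x.1 y.1 := hxy
    refine H.height_lt _ _ hadj fun e => ?_
    have h1 := H.label_in hadj
    rw [e, y.2.resolve_left hyb] at h1
    rcases h1 with h1 | h1
    · exact hloop y.1 (h1 ▸ hadj)
    · exact hxb h1
  have hpw : p.Pairwise fun x y : partOf G label b => h x < h y := by
    have : IsTrans (partOf G label b) fun x y => h x < h y := ⟨fun _ _ _ => lt_trans⟩
    exact List.isChain_iff_pairwise.mp hlt
  match p, hlen, hends, hpw with
  | x :: y :: q, _, hends, hpw =>
    rw [List.head?_cons, List.getLast?_cons_cons] at hends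
    exact lt_irrefl _ (List.rel_of_pairwise_cons hpw (List.mem_of_getLast? hends.symm))

/-- Every vertex is a descendant of a vertex which is its own parent. -/
theorem exists_root [Finite V] (H : IsSwapLabeling G label h) (v : V) :
    ∃ r, parentOf G label r = r ∧ ∃ n : ℕ, (parentOf G label)^[n] v = r := by
  obtain ⟨N, hN⟩ := (Set.finite_range h).bddAbove
  induction hk : N - h v using Nat.strong_induction_on generalizing v with
  | _ k ih =>
    by_cases hv : parentOf G label v = v
    · exact ⟨v, hv, 0, rfl⟩
    have hlt := H.height_lt_parentOf hv
    have hle : h (parentOf G label v) ≤ N := hN ⟨_, rfl⟩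
    obtain ⟨r, hr, n, hn⟩ := ih _ (by omega) (parentOf G label v) rfl
    exact ⟨r, hr, n + 1, hn⟩

/-- A vertex is below a root `r` if and only if its image is; `r` itself, as a fixed point of `f`,
counts as being below `r`. -/
theorem iterate_eq_root_iff {f : V → V} {r : V} (hr : f r = r) (v : V) :
    (∃ n : ℕ, f^[n] (f v) = r) ↔ ∃ n : ℕ, f^[n] v = r := by
  constructor
  · rintro ⟨n, hn⟩
    exact ⟨n + 1, hn⟩
  · rintro ⟨n, rfl⟩
    exact ⟨n, by rw [← Function.iterate_succ_apply, Function.iterate_succ_apply', hr]⟩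

end IsSwapLabeling

theorem isReuniclus_of_label [Finite V] [Nonempty V] (hloop : ∀ v, ¬ G.Adj v v)
    (hconn : StronglyConnected G) (H : IsSwapLabeling G label h) : IsReuniclus G := by
  set par := parentOf G label with hpar
  obtain ⟨root, hroot, -⟩ := H.exists_root (Classical.arbitrary V)
  -- Both ends of an arc are below the same roots: its label is on both of their paths.
  have hstep : ∀ u v, G.Adj u v →
      ((∃ n : ℕ, par^[n] u = root) ↔ ∃ n : ℕ, par^[n] v = root) := by
    intro u v huv
    have aux : ∀ z, label u v = z ∨ label u v = par z →
        ((∃ n : ℕ, par^[n] (label u v) = root) ↔ ∃ n : ℕ, par^[n] z = root) := by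
      rintro z (e | e)
      · rw [e]
      · rw [e]
        exact IsSwapLabeling.iterate_eq_root_iff hroot z
    exact (aux u (H.label_out huv)).symm.trans (aux v (H.label_in huv))
  have hall : ∀ v, ∃ n : ℕ, par^[n] v = root := by
    intro v
    induction hconn root v with
    | refl => exact ⟨0, rfl⟩
    | tail _ huv ih => exact (hstep _ _ huv).mp ih
  refine ⟨Set.range par, root, par, partOf G label, ⟨⟨root, hroot⟩, fun b _ _ => ⟨b, rfl⟩,
    fun b _ => hall b⟩, fun v => ⟨par v, ⟨v, rfl⟩, Or.inr rfl⟩, ?_, ?_, ?_, ?_⟩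
  · intro u v huv
    refine ⟨label u v, ?_, H.left_mem_partOf huv, H.right_mem_partOf huv⟩
    rcases H.label_out huv with e | e
    · rcases H.label_in huv with e' | e'
      · exact absurd (e.symm.trans e') (fun e'' => hloop v (by rwa [e''] at huv))
      · exact ⟨v, e'.symm⟩
    · exact ⟨u, e.symm⟩
  · intro b _
    exact ⟨fun u v => (H.reflTransGen_to (Or.inl rfl) u).1.trans (H.reflTransGen_from _ v),
      Or.inl rfl, H.isBottleneckVertex hloop _⟩
  · intro u hu
    refine ⟨par u, ⟨⟨u, rfl⟩, Or.inr rfl⟩, ?_⟩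
    rintro b ⟨hb, rfl | e⟩
    · exact absurd hb hu
    · exact e.symm
  · intro b _ c _
    constructor
    · rintro (e | e)
      · exact Or.inl e.symm
      · by_cases hb : b = root
        · subst hb
          exact Or.inl (e.symm.trans hroot)
        · exact Or.inr ⟨hb, e.symm⟩
    · rintro (e | ⟨-, e⟩)
      · exact Or.inl e.symm
      · exact Or.inr e.symm

end Labels

/-! ### Executions -/

section Executions

variable {G : Digraph V} {P : Protocol V} {C : Set V} {dev : ℕ → V → Action V}

theorem team_of_notMem {v : V} (hv : v ∉ C) : team C v = {v} := by
  ext w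
  simp [team, hv]

theorem mem_team_self (C : Set V) (v : V) : v ∈ team C v := Or.inl rfl

open Classical in
/-- The actions taken at time `t`. -/
noncomputable def actions (G : Digraph V) (P : Protocol V) (C : Set V) (dev : ℕ → V → Action V)
    (t : ℕ) (v : V) : Action V :=
  if v ∈ C then dev t v else P v ((run G P C dev t).2 v)

theorem run_succ (t : ℕ) : (run G P C dev (t + 1)).1 =
    step G C t (actions G P C dev t) (run G P C dev t).1 := rfl

theorem step_contract_eq_some {t : ℕ} {act : V → Action V} {s : State V} {u w : V}
    {c : Contract V} : (step G C t act s).contract u w = some c ↔ s.contract u w = some c ∨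
      s.contract u w = none ∧ (act u).create w = some c ∧ G.Adj u w ∧ ∃ m ∈ team C u,
        State.KnowsHashlock { s with secret := fun v => s.secret v ∨ (act v).createSecret }
          m c.hashlock := by
  simp only [step, Option.or_eq_some_iff, Option.filter_eq_some_iff, decide_eq_true_eq]

theorem contract_mono {t t' : ℕ} (h : t ≤ t') {u w : V} {c : Contract V}
    (hc : (run G P C dev t).1.contract u w = some c) :
    (run G P C dev t').1.contract u w = some c := by
  induction h with
  | refl => exact hc
  | step _ ih => exact run_succ (G := G) _ ▸ step_contract_eq_some.mpr (Or.inl ih)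

theorem contract_unique {t t' : ℕ} {u w : V} {c c' : Contract V}
    (hc : (run G P C dev t).1.contract u w = some c)
    (hc' : (run G P C dev t').1.contract u w = some c') : c = c' :=
  Option.some_injective _ ((contract_mono (le_max_left t t') hc).symm.trans
    (contract_mono (le_max_right t t') hc'))

theorem claimed_mono {t t' : ℕ} (h : t ≤ t') {u w : V}
    (hc : (run G P C dev t).1.claimed u w) : (run G P C dev t').1.claimed u w := by
  induction h with
  | refl => exact hc
  | step _ ih => exact Or.inl ih

/-- A contract that does not exist at time `d` is created at some time from `d` on. -/
theorem exists_create_step {d t : ℕ} {u w : V} {c : Contract V}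
    (hc : (run G P C dev t).1.contract u w = some c)
    (hd : (run G P C dev d).1.contract u w = none) :
    ∃ t' ≥ d, (run G P C dev t').1.contract u w = none ∧
      (actions G P C dev t' u).create w = some c ∧ G.Adj u w := by
  induction t with
  | zero => simp [run, State.init] at hc
  | succ t ih =>
    rw [run_succ] at hc
    rcases step_contract_eq_some.mp hc with h | ⟨h1, h2, h3, -⟩
    · exact ih h
    · refine ⟨t, ?_, h1, h2, h3⟩
      by_contra! hlt
      rw [← run_succ] at hc
      rw [contract_mono hlt hc] at hd
      exact Option.some_ne_none _ hd

theorem adj_of_contract {t : ℕ} {u w : V} {c : Contract V}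
    (hc : (run G P C dev t).1.contract u w = some c) : G.Adj u w := by
  obtain ⟨-, -, -, -, h⟩ := exists_create_step (d := 0) hc rfl
  exact h

/-- An asset that is not claimed at time `d` is claimed at some time from `d` on. -/
theorem exists_claim_step {d t : ℕ} {u w : V} (hc : (run G P C dev t).1.claimed u w)
    (hd : ¬ (run G P C dev d).1.claimed u w) :
    ∃ t' ≥ d, (actions G P C dev t' w).claim u ∧
      ∃ c, (run G P C dev t').1.contract u w = some c ∧ t' ≤ c.timeout ∧
        ∃ m ∈ team C w, (run G P C dev t').1.KnowsSecret m c.hashlock := by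
  induction t with
  | zero => exact hc.elim
  | succ t ih =>
    by_cases h : (run G P C dev t).1.claimed u w
    · exact ih h
    · refine ⟨t, ?_, hc.resolve_left h⟩
      by_contra! hlt
      exact hd (claimed_mono hlt hc)

theorem exists_contract_of_claimed {t : ℕ} {u w : V} (hc : (run G P C dev t).1.claimed u w) :
    ∃ c, (run G P C dev t).1.contract u w = some c := by
  induction t with
  | zero => exact hc.elim
  | succ t ih =>
    rcases hc with h | ⟨-, c, h, -⟩
    · obtain ⟨c, h⟩ := ih h
      exact ⟨c, contract_mono t.le_succ h⟩
    · exact ⟨c, contract_mono t.le_succ h⟩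

/-- The hashlocks in use are those of existing secrets. -/
theorem secret_of_hashlock (t : ℕ) :
    (∀ u w c, (run G P C dev t).1.contract u w = some c →
      (run G P C dev t).1.secret c.hashlock) ∧
    ∀ u w x, (run G P C dev t).1.told u w x → (run G P C dev t).1.secret x := by
  induction t with
  | zero => exact ⟨fun _ _ _ h => by simp [run, State.init] at h, fun _ _ _ h => h.elim⟩
  | succ t ih =>
    have key : ∀ m x, State.KnowsHashlock
        { (run G P C dev t).1 with
          secret := fun v => (run G P C dev t).1.secret v ∨
            (actions G P C dev t v).createSecret } m x →
        (run G P C dev (t + 1)).1.secret x := by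
      rintro m x (⟨-, h⟩ | ⟨u, h⟩ | ⟨u, c, h, rfl⟩)
      · exact h
      · exact Or.inl (ih.2 _ _ _ h)
      · exact Or.inl (ih.1 _ _ _ h)
    constructor
    · intro u w c hc
      rw [run_succ] at hc
      rcases step_contract_eq_some.mp hc with h | ⟨-, -, -, m, -, h⟩
      · exact Or.inl (ih.1 _ _ _ h)
      · exact key _ _ h
    · rintro u w x (h | ⟨-, m, -, h⟩)
      · exact Or.inl (ih.2 _ _ _ h)
      · exact key _ _ h

end Executions

/-! ### Deviations that branch off from the honest execution -/

section Deviations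

variable {G : Digraph V} {P : Protocol V} {C : Set V}

/-- The execution in which all parties follow the protocol. -/
noncomputable def honestRun (G : Digraph V) (P : Protocol V) (t : ℕ) :
    State V × (V → List (View V)) :=
  run G P ∅ (fun _ _ => Action.idle) t

open Classical in
/-- The parties act as in the honest execution before time `d`. From `d` on they do nothing, except
that `x` claims the asset of `u` if `p x u`.  Before `d`, a party asks for what is present in the
next state of the honest execution, rather than for what the protocol tells it: some requests
without effect in the honest execution might be permitted when knowledge is shared. -/
noncomputable def deviation (G : Digraph V) (P : Protocol V) (d : ℕ) (p : V → V → Prop)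
    (t : ℕ) (x : V) : Action V :=
  if t < d then
    { createSecret := (honestRun G P (t + 1)).1.secret x
      create := (honestRun G P (t + 1)).1.contract x
      claim := fun u => (honestRun G P (t + 1)).1.claimed u x
      tell := (honestRun G P (t + 1)).1.told x }
  else { Action.idle with claim := p x }

variable {d : ℕ} {p : V → V → Prop}

theorem actions_of_notMem {dev : ℕ → V → Action V} {t : ℕ} {v : V} (hv : v ∉ C) :
    actions G P C dev t v = P v ((run G P C dev t).2 v) := if_neg hv

theorem actions_deviation {t : ℕ} (ht : d ≤ t) {x : V} (hx : x ∈ C) :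
    actions G P C (deviation G P d p) t x = { Action.idle with claim := p x } := by
  rw [actions, if_pos hx, deviation, if_neg ht.not_gt]

/-- Up to time `d`, the deviation cannot be told from the honest execution, in states or views. -/
theorem run_deviation {t : ℕ} (ht : t ≤ d) :
    run G P C (deviation G P d p) t = honestRun G P t := by
  induction t with
  | zero => rfl
  | succ t ih =>
    have ih := ih (by omega)
    set s := (honestRun G P t).1 with hs
    set s' := (honestRun G P (t + 1)).1 with hs'
    have hstep : s' = step G ∅ t (fun v => P v ((honestRun G P t).2 v)) s := by
      rw [hs', honestRun, run_succ]
      congr 1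
      funext v
      exact actions_of_notMem (Set.notMem_empty v)
    have hdev : ∀ x, x ∈ C → actions G P C (deviation G P d p) t x =
        { createSecret := s'.secret x, create := s'.contract x,
          claim := fun u => s'.claimed u x, tell := s'.told x } := by
      intro x hx
      rw [actions, if_pos hx, deviation, if_pos (by omega)]
    have hpro : ∀ x, x ∉ C → actions G P C (deviation G P d p) t x =
        P x ((honestRun G P t).2 x) := by
      intro x hx
      rw [actions_of_notMem hx, ih]
    set act := actions G P C (deviation G P d p) t with hact
    have hteam : ∀ v m : V, m ∈ team ∅ v → m ∈ team C v := by
      rintro v m (h | h)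
      · exact Or.inl h
      · exact absurd h.1 (Set.notMem_empty v)
    have hempty : ∀ v : V, team ∅ v = {v} := fun v => team_of_notMem (Set.notMem_empty v)
    have hsecret : ∀ x, (s.secret x ∨ (act x).createSecret) ↔
        (s.secret x ∨ (P x ((honestRun G P t).2 x)).createSecret) := by
      intro x
      by_cases hx : x ∈ C
      · rw [hdev x hx, hstep]
        simp [step]
      · rw [hpro x hx]
    have hsecret' : (fun x => s.secret x ∨ (act x).createSecret) =
        fun x => s.secret x ∨ (P x ((honestRun G P t).2 x)).createSecret :=
      funext fun x => propext (hsecret x)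
    have main : step G C t act s = s' := by
      have e1 : (step G C t act s).secret = s'.secret := by
        rw [hstep]
        exact hsecret'
      have e2 : (step G C t act s).contract = s'.contract := by
        funext u w
        refine Option.ext fun c => ?_
        rw [step_contract_eq_some, hsecret']
        by_cases hu : u ∈ C
        · rw [hdev u hu]
          constructor
          · rintro (h | ⟨-, h, -⟩)
            · rw [hstep]
              exact step_contract_eq_some.mpr (Or.inl h)
            · exact h
          · intro h
            have h' := h
            rw [hstep] at h'
            rcases step_contract_eq_some.mp h' with h1 | ⟨h1, -, h3, m, hm, h4⟩
            · exact Or.inl h1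
            · exact Or.inr ⟨h1, h, h3, m, hteam _ _ hm, h4⟩
        · rw [hpro u hu, hstep, step_contract_eq_some, team_of_notMem hu, hempty]
      have e3 : (step G C t act s).claimed = s'.claimed := by
        funext u w
        apply propext
        by_cases hw : w ∈ C
        · constructor
          · rintro (h | ⟨h, -⟩)
            · rw [hstep]
              exact Or.inl h
            · rw [hdev w hw] at h
              exact h
          · intro h
            have h' := h
            rw [hstep] at h'
            rcases h' with h1 | ⟨-, c, h2, h3, m, hm, h4⟩
            · exact Or.inl h1
            · exact Or.inr ⟨by rw [hdev w hw]; exact h, c, h2, h3, m, hteam _ _ hm, h4⟩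
        · rw [hstep]
          simp only [step, hpro w hw, team_of_notMem hw, hempty]
      have e4 : (step G C t act s).told = s'.told := by
        funext u w x
        apply propext
        by_cases hu : u ∈ C
        · constructor
          · rintro (h | ⟨h, -⟩)
            · rw [hstep]
              exact Or.inl h
            · rw [hdev u hu] at h
              exact h
          · intro h
            have h' := h
            rw [hstep] at h'
            rcases h' with h1 | ⟨-, m, hm, h4⟩
            · exact Or.inl h1
            · refine Or.inr ⟨by rw [hdev u hu]; exact h, m, hteam _ _ hm, ?_⟩
              rw [hsecret']
              exact h4
        · rw [hstep]
          simp only [step, hpro u hu, team_of_notMem hu, hempty, hsecret']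
      generalize step G C t act s = a at *
      cases a
      cases hb : s'
      simp_all only
    have h1 : (run G P C (deviation G P d p) (t + 1)).1 = s' := by
      rw [run_succ, ih]
      exact main
    refine Prod.ext h1 ?_
    have h2 : (run G P C (deviation G P d p) (t + 1)).2 = fun v =>
      (run G P C (deviation G P d p) (t + 1)).1.view v ::
        (run G P C (deviation G P d p) t).2 v := rfl
    rw [h2, h1, ih]
    rfl

end Deviations

/-! ### Consequences of atomicity -/

section Atomicity

variable {G : Digraph V} {P : Protocol V}

theorem exists_contract_of_live (hlive : IsLive G P) {u v : V} (huv : G.Adj u v) :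
    ∃ t c, (honestRun G P t).1.contract u v = some c := by
  obtain ⟨t, ht⟩ := hlive u v huv
  obtain ⟨c, hc⟩ := exists_contract_of_claimed ht
  exact ⟨t, c, hc⟩

/-- As each asset is claimed eventually in the honest execution, contracts that are still unclaimed
have not timed out. -/
theorem le_timeout_of_live (hlive : IsLive G P) {t d : ℕ} {u v : V} {c : Contract V}
    (hc : (honestRun G P t).1.contract u v = some c)
    (hd : ¬ (honestRun G P d).1.claimed u v) : d ≤ c.timeout := by
  obtain ⟨t', ht'⟩ := hlive u v (adj_of_contract hc)
  obtain ⟨s, hs, -, c', hc', hle, -⟩ := exists_claim_step ht' hd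
  rw [contract_unique hc hc']
  exact hs.trans hle

/-- If the contract `(v, w)` is protected by another party, then at the moment it is created, or at
any later time `d` with `(v, w)` unclaimed, all contracts entering `v` exist, and their secrets are
available to `v` from its own pair, from `(v, w)`, or from what `v` knows at time `d`.  Otherwise
the other parties put `v` underwater by claiming only `(v, w)`, and doing nothing else from `d` on.
(They may have to wait until `d + 1` if `(v, w)` is created at time `d`.) -/
theorem exists_contract_of_exposed (hloop : ∀ v, ¬ G.Adj v v) (hlive : IsLive G P)
    (hsafe : IsSafe G P) {d : ℕ} {v w : V} {c : Contract V}
    (hc : (honestRun G P (d + 1)).1.contract v w = some c) (hy : c.hashlock ≠ v)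
    (hd : ¬ (honestRun G P d).1.claimed v w) {u : V} (huv : G.Adj u v) :
    ∃ c', (honestRun G P d).1.contract u v = some c' ∧
      (c'.hashlock = c.hashlock ∨ c'.hashlock = v ∨
        (honestRun G P d).1.KnowsSecret v c'.hashlock) := by
  have hvw : G.Adj v w := adj_of_contract hc
  have hne : ∀ {a b}, G.Adj a b → a ≠ b := fun hab e => hloop _ (e ▸ hab)
  set C : Set V := {v}ᶜ with hC
  have hv : v ∉ C := by simp [hC]
  have hmem : ∀ {x}, x ≠ v → x ∈ C := fun hx => by simpa [hC] using hx
  set dev := deviation G P d (fun x a => x = w ∧ a = v) with hdev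
  have hrun : run G P C dev d = honestRun G P d := run_deviation le_rfl
  have hact : actions G P C dev d v = actions G P ∅ (fun _ _ => Action.idle) d v := by
    rw [actions_of_notMem hv, actions_of_notMem (Set.notMem_empty v), hrun]
    rfl
  have hteam : team C v = team ∅ v := by
    rw [team_of_notMem hv, team_of_notMem (Set.notMem_empty v)]
  -- The party `v` does not notice the deviation before `d + 1`, so it creates `(v, w)`.
  have hc1 : (run G P C dev (d + 1)).1.contract v w = some c := by
    rw [honestRun, run_succ, step_contract_eq_some] at hc
    rw [run_succ, step_contract_eq_some, hrun, hact, hteam]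
    refine hc.imp id fun ⟨h1, h2, h3, m, hm, h4⟩ => ⟨h1, h2, h3, m, hm, ?_⟩
    have hmv : m = v := by simpa [team] using hm
    subst hmv
    refine h4.imp (fun ⟨e, h⟩ => ⟨e, ?_⟩) id
    simp only [← e] at h ⊢
    rwa [hact]
  have hw : w ∈ C := hmem (hne hvw).symm
  have claimable : ∀ e ≥ d, (run G P C dev e).1.contract v w = some c → e ≤ c.timeout →
      (run G P C dev (e + 1)).1.claimed v w := by
    intro e he hce hle
    refine Or.inr ⟨?_, c, hce, hle, c.hashlock, Or.inr ⟨hw, hmem hy⟩, Or.inl ⟨rfl, ?_⟩⟩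
    · change (actions G P C dev e w).claim v
      rw [actions_deviation he hw]
      exact ⟨rfl, rfl⟩
    · exact (secret_of_hashlock e).1 _ _ _ hce
  have hclaimed : ∃ t, (run G P C dev t).1.claimed v w := by
    cases hex : (honestRun G P d).1.contract v w with
    | some c₀ =>
      have hc₀ : c₀ = c := contract_unique hex hc
      subst hc₀
      exact ⟨d + 1, claimable d le_rfl (by rwa [hrun]) (le_timeout_of_live hlive hex hd)⟩
    | none =>
      refine ⟨d + 2, claimable (d + 1) d.le_succ hc1 (le_timeout_of_live hlive hc fun h => ?_)⟩
      rcases h with h | ⟨-, c', h, -⟩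
      · exact hd h
      · rw [honestRun] at hex
        rw [hex] at h
        exact Option.some_ne_none _ h.symm
  have hrel : (v, w) ∈ (outcome G (transferred G P C dev) {v}).relinquished :=
    ⟨hclaimed, hvw, rfl, (hne hvw).symm⟩
  have hacq : (u, v) ∈ (outcome G (transferred G P C dev) {v}).acquired := by
    rcases hsafe C dev v hv with h | h
    · rw [h]
      exact ⟨huv, hne huv, rfl⟩
    · rw [h] at hrel
      exact hrel.elim
  obtain ⟨⟨t, ht⟩, -⟩ := hacq
  -- The knowledge of `v`, and the contracts it can claim, in the deviating execution.
  have hknow : ∀ s x, (run G P C dev s).1.KnowsSecret v x →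
      x = c.hashlock ∨ x = v ∨ (honestRun G P d).1.KnowsSecret v x := by
    rintro s x (⟨rfl, -⟩ | ⟨w', c', hc', hcl, rfl⟩)
    · exact Or.inr (Or.inl rfl)
    by_cases hold : (run G P C dev d).1.claimed v w'
    · obtain ⟨c₀, hc₀⟩ := exists_contract_of_claimed hold
      obtain rfl := contract_unique hc₀ hc'
      rw [hrun] at hold hc₀
      exact Or.inr (Or.inr (Or.inr ⟨w', c₀, hc₀, hold, rfl⟩))
    · obtain ⟨s', hs', hcl', -⟩ := exists_claim_step hcl hold
      rw [actions_deviation hs' (hmem (hne (adj_of_contract hc')).symm)] at hcl'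
      obtain rfl := hcl'.1
      exact Or.inl (congrArg _ (contract_unique hc' hc1))
  have hcontract : ∀ s c', (run G P C dev s).1.contract u v = some c' →
      (honestRun G P d).1.contract u v = some c' := by
    intro s c' hc'
    cases hex : (run G P C dev d).1.contract u v with
    | some c₀ =>
      rw [← hrun, hex, contract_unique hex hc']
    | none =>
      obtain ⟨s', hs', -, hcr, -⟩ := exists_create_step hc' hex
      rw [actions_deviation hs' (hmem (hne huv))] at hcr
      exact (Option.some_ne_none _ hcr.symm).elim
  obtain ⟨s, -, -, c', hc', -, m, hm, hk⟩ := exists_claim_step (d := 0) ht id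
  rw [team_of_notMem hv, Set.mem_singleton_iff] at hm
  subst hm
  exact ⟨c', hcontract s c' hc', hknow s _ hk⟩

/-- When all contracts entering `v` exist, and `v` has claimed them or knows their secrets, then all
contracts leaving `v` exist.  Otherwise `v` can claim everything and not create the missing one. -/
theorem exists_contract_of_nash (pref : ∀ C : Set V, Preference G C) (hloop : ∀ v, ¬ G.Adj v v)
    (hlive : IsLive G P) (hnash : IsStrongNash G pref P) {d : ℕ} {v w : V} (hvw : G.Adj v w)
    (hin : ∀ u, G.Adj u v → ∃ c, (honestRun G P d).1.contract u v = some c ∧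
      ((honestRun G P d).1.claimed u v ∨ (honestRun G P d).1.KnowsSecret v c.hashlock)) :
    ∃ c, (honestRun G P d).1.contract v w = some c := by
  by_contra! hnone
  rw [← Option.eq_none_iff_forall_ne_some] at hnone
  have hne : ∀ {a b}, G.Adj a b → a ≠ b := fun hab e => hloop _ (e ▸ hab)
  set C : Set V := {v} with hC
  have hv : v ∈ C := rfl
  set dev := deviation G P d (fun _ _ => True) with hdev
  have hrun : run G P C dev d = honestRun G P d := run_deviation le_rfl
  have hall : ∀ u, G.Adj u v → (run G P C dev (d + 1)).1.claimed u v := by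
    intro u huv
    by_cases hcl : (honestRun G P d).1.claimed u v
    · rw [← hrun] at hcl
      exact claimed_mono d.le_succ hcl
    obtain ⟨c, hc, hk⟩ := hin u huv
    have hk := hk.resolve_left hcl
    refine Or.inr ⟨?_, c, by rwa [hrun], le_timeout_of_live hlive hc hcl, v, mem_team_self _ _,
      by rwa [hrun]⟩
    change (actions G P C dev d v).claim u
    rw [actions_deviation le_rfl hv]
    trivial
  have hnever : (v, w) ∉ transferred G P C dev := by
    rintro ⟨t, ht⟩
    obtain ⟨c, hc⟩ := exists_contract_of_claimed ht
    obtain ⟨t', ht', -, hcr, -⟩ := exists_create_step hc (by rw [hrun]; exact hnone)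
    rw [actions_deviation ht' hv] at hcr
    exact Option.some_ne_none _ hcr.symm
  apply hnash C dev
  let _ := (pref C).toPartialOrder
  have hle : outcome G (conforming G P) C ≤ outcome G (transferred G P C dev) C := by
    apply (pref C).mono
    · rintro ⟨u, x⟩ ⟨-, hux⟩
      have hx : x = v := hux.2.2
      subst hx
      exact ⟨⟨d + 1, hall u hux.1⟩, hux⟩
    · rintro ⟨x, y⟩ ⟨-, hxy⟩
      exact ⟨hlive x y hxy.1, hxy⟩
  refine lt_of_le_of_ne hle fun e => hnever ?_
  have hmem : (v, w) ∈ (outcome G (conforming G P) C).relinquished :=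
    ⟨hlive v w hvw, hvw, rfl, (hne hvw).symm⟩
  rw [e] at hmem
  exact hmem.1

/-- `label u v` is the party that protects the contract `(u, v)` in the honest execution. -/
def IsContractLabel (G : Digraph V) (P : Protocol V) (label : V → V → V) : Prop :=
  ∀ t u v c, (honestRun G P t).1.contract u v = some c → c.hashlock = label u v

open Classical in
theorem exists_isContractLabel (G : Digraph V) (P : Protocol V) :
    ∃ label, IsContractLabel G P label := by
  refine ⟨fun u v => if h : ∃ t c, (honestRun G P t).1.contract u v = some c
    then h.choose_spec.choose.hashlock else u, fun t u v c hc => ?_⟩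
  have h : ∃ t c, (honestRun G P t).1.contract u v = some c := ⟨t, c, hc⟩
  simp only [dif_pos h]
  exact congrArg _ (contract_unique hc h.choose_spec.choose_spec)

/-- A contract whose arc is not protected by the seller is created after all contracts entering
the seller. -/
theorem exists_contract_before (hloop : ∀ v, ¬ G.Adj v v) (hlive : IsLive G P)
    (hsafe : IsSafe G P) {label : V → V → V} (hlabel : IsContractLabel G P label) {t : ℕ} {v w : V}
    (hl : label v w ≠ v) (ht : (honestRun G P t).1.contract v w = none)
    (ht' : (honestRun G P (t + 1)).1.contract v w ≠ none) {u : V} (huv : G.Adj u v) :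
    ∃ c, (honestRun G P t).1.contract u v = some c := by
  obtain ⟨c, hc⟩ := Option.ne_none_iff_exists'.mp ht'
  obtain ⟨c', hc', -⟩ := exists_contract_of_exposed hloop hlive hsafe hc
    (by rwa [hlabel _ _ _ _ hc]) (fun h => by
      obtain ⟨c₀, hc₀⟩ := exists_contract_of_claimed h
      exact Option.some_ne_none _ (hc₀.symm.trans ht)) huv
  exact ⟨c', hc'⟩

theorem exists_creation_time (hlive : IsLive G P) {u v : V} (huv : G.Adj u v) :
    ∃ t, (honestRun G P t).1.contract u v = none ∧
      (honestRun G P (t + 1)).1.contract u v ≠ none := by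
  by_contra! hcon
  have : ∀ t, (honestRun G P t).1.contract u v = none := by
    intro t
    induction t with
    | zero => rfl
    | succ t ih => exact hcon t ih
  obtain ⟨t, c, hc⟩ := exists_contract_of_live hlive huv
  exact Option.some_ne_none _ (hc.symm.trans (this t))

/-- If an arc leaving `v` has a label `y` other than `v`, then the labels of the arcs entering `v`
are `y`, which occurs, and possibly `v`. -/
theorem label_in_of_foreign (pref : ∀ C : Set V, Preference G C) (hloop : ∀ v, ¬ G.Adj v v)
    (hlive : IsLive G P) (hsafe : IsSafe G P) (hnash : IsStrongNash G pref P)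
    {label : V → V → V} (hlabel : IsContractLabel G P label) {v w : V} (hvw : G.Adj v w)
    (hl : label v w ≠ v) :
    (∃ u, G.Adj u v ∧ label u v = label v w) ∧
      ∀ u, G.Adj u v → label u v = label v w ∨ label u v = v := by
  classical
  -- If only `v` occurred as a label, it would take everything instead of creating `(v, w)`.
  have hforeign : ∃ u, G.Adj u v ∧ label u v ≠ v := by
    by_contra! hself
    obtain ⟨t, ht, ht'⟩ := exists_creation_time hlive hvw
    obtain ⟨c, hc⟩ := exists_contract_of_nash pref hloop hlive hnash hvw (d := t) fun u huv => by
      obtain ⟨c, hc⟩ := exists_contract_before hloop hlive hsafe hlabel hl ht ht' huv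
      have e : c.hashlock = v := (hlabel _ _ _ _ hc).trans (hself u huv)
      refine ⟨c, hc, Or.inr (Or.inl ⟨e.symm, ?_⟩)⟩
      exact (secret_of_hashlock t).1 _ _ _ hc
    exact Option.some_ne_none _ (hc.symm.trans ht)
  -- The step `T` in which the first foreign arc leaving `v`, here `(v, w₀)`, is claimed.
  have hex : ∃ t, ∃ x, G.Adj v x ∧ label v x ≠ v ∧ (honestRun G P (t + 1)).1.claimed v x := by
    obtain ⟨t, ht⟩ := hlive v w hvw
    exact ⟨t, w, hvw, hl, claimed_mono t.le_succ ht⟩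
  obtain ⟨T, ⟨w₀, hvw₀, hl₀, hcl₀⟩, hmin⟩ :
      ∃ T, (∃ x, G.Adj v x ∧ label v x ≠ v ∧ (honestRun G P (T + 1)).1.claimed v x) ∧
        ∀ x, G.Adj v x → label v x ≠ v → ¬ (honestRun G P T).1.claimed v x := by
    refine ⟨Nat.find hex, Nat.find_spec hex, fun x hx hlx hcl => ?_⟩
    cases hT : Nat.find hex with
    | zero => rw [hT] at hcl; exact hcl
    | succ k =>
      rw [hT] at hcl
      exact Nat.find_min hex (hT ▸ k.lt_succ_self) ⟨x, hx, hlx, hcl⟩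
  have hknow : ∀ x, (honestRun G P T).1.KnowsSecret v x → x = v := by
    rintro x (⟨e, -⟩ | ⟨w', c', hc', hcl', rfl⟩)
    · exact e.symm
    · by_contra hx
      rw [hlabel _ _ _ _ hc'] at hx
      exact hmin w' (adj_of_contract hc') hx hcl'
  have hone : ∀ x, label v x ≠ v → ∀ c, (honestRun G P (T + 1)).1.contract v x = some c →
      ∀ u, G.Adj u v → (∃ c', (honestRun G P T).1.contract u v = some c') ∧
        (label u v = label v x ∨ label u v = v) := by
    intro x hlx c hc u huv
    obtain ⟨c', hc', h⟩ := exists_contract_of_exposed hloop hlive hsafe hc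
      (by rwa [hlabel _ _ _ _ hc]) (hmin x (adj_of_contract hc) hlx) huv
    rw [hlabel _ _ _ _ hc, hlabel _ _ _ _ hc'] at h
    exact ⟨⟨c', hc'⟩, h.imp_right fun h => h.elim id (hknow _)⟩
  obtain ⟨c₀, hc₀⟩ := exists_contract_of_claimed hcl₀
  -- Once `(v, w₀)` is claimed, `v` can claim everything, so it must have created `(v, w)`.
  obtain ⟨c, hc⟩ := exists_contract_of_nash pref hloop hlive hnash hvw (d := T + 1)
    fun u huv => by
      obtain ⟨⟨c, hc⟩, h⟩ := hone w₀ hl₀ c₀ hc₀ u huv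
      have hc := contract_mono T.le_succ hc
      refine ⟨c, hc, Or.inr ?_⟩
      rcases h with h | h
      · refine Or.inr ⟨w₀, c₀, hc₀, hcl₀, ?_⟩
        rw [hlabel _ _ _ _ hc₀, hlabel _ _ _ _ hc, h]
      · exact Or.inl ⟨(hlabel _ _ _ _ hc).trans h |>.symm, (secret_of_hashlock _).1 _ _ _ hc⟩
  have honly := fun u huv => (hone w hl c hc u huv).2
  obtain ⟨u, huv, hu⟩ := hforeign
  exact ⟨⟨u, huv, (honly u huv).resolve_right hu⟩, honly⟩

/-- A buyer that does not protect its incoming contract itself learns the secret as a seller. -/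
theorem exists_relay (hlive : IsLive G P) {label : V → V → V}
    (hlabel : IsContractLabel G P label) {u v : V} (huv : G.Adj u v) (hl : label u v ≠ v) :
    ∃ w, G.Adj v w ∧ label v w = label u v := by
  obtain ⟨t, ht⟩ := hlive u v huv
  obtain ⟨s, -, -, c, hc, -, m, hm, hk⟩ := exists_claim_step (d := 0) ht id
  rw [team_of_notMem (Set.notMem_empty v), Set.mem_singleton_iff] at hm
  subst hm
  rcases hk with ⟨e, -⟩ | ⟨w, c', hc', -, e⟩
  · exact absurd ((hlabel _ _ _ _ hc).symm.trans e.symm) hl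
  · exact ⟨w, adj_of_contract hc',
      (hlabel _ _ _ _ hc').symm.trans (e.trans (hlabel _ _ _ _ hc))⟩

/-- The height of `v` is the time by which all contracts entering `v` are created. -/
theorem exists_height [Finite V] (hloop : ∀ v, ¬ G.Adj v v) (hlive : IsLive G P)
    (hsafe : IsSafe G P) {label : V → V → V} (hlabel : IsContractLabel G P label) :
    ∃ h : V → ℕ, ∀ v w, G.Adj v w → label v w ≠ v → h v < h w := by
  classical
  have hex : ∀ v, ∃ n, ∀ u, G.Adj u v → ∃ c, (honestRun G P n).1.contract u v = some c := by
    intro v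
    have h1 : ∀ u, ∃ n, G.Adj u v → ∃ c, (honestRun G P n).1.contract u v = some c := by
      intro u
      by_cases huv : G.Adj u v
      · obtain ⟨n, hn⟩ := exists_contract_of_live hlive huv
        exact ⟨n, fun _ => hn⟩
      · exact ⟨0, fun h => absurd h huv⟩
    choose n hn using h1
    obtain ⟨N, hN⟩ := (Set.finite_range n).bddAbove
    refine ⟨N, fun u huv => ?_⟩
    obtain ⟨c, hc⟩ := hn u huv
    exact ⟨c, contract_mono (hN ⟨u, rfl⟩) hc⟩
  refine ⟨fun v => Nat.find (hex v), fun v w hvw hl => ?_⟩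
  obtain ⟨t, ht, ht'⟩ := exists_creation_time hlive hvw
  have h1 : Nat.find (hex v) ≤ t := Nat.find_min' (hex v) fun u huv =>
    exists_contract_before hloop hlive hsafe hlabel hl ht ht' huv
  refine h1.trans_lt ?_
  by_contra! hle
  obtain ⟨c, hc⟩ := Nat.find_spec (hex w) v hvw
  exact Option.some_ne_none _ ((contract_mono hle hc).symm.trans ht)

end Atomicity

end AssetSwap

theorem mainTheorem2 {V : Type*} [Finite V] [Nonempty V] (G : Digraph V)
    (hloop : ∀ v, ¬ G.Adj v v) (hconn : AssetSwap.StronglyConnected G)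
    (pref : ∀ C : Set V, AssetSwap.Preference G C)
    (hP : ∃ P : AssetSwap.Protocol V, AssetSwap.IsAtomic G pref P) :
    AssetSwap.IsReuniclus G := by
  obtain ⟨P, hlive, hsafe, hnash⟩ := hP
  obtain ⟨label, hlabel⟩ := AssetSwap.exists_isContractLabel G P
  obtain ⟨h, hh⟩ := AssetSwap.exists_height hloop hlive hsafe hlabel
  have key := fun v w (hvw : G.Adj v w) (hl : label v w ≠ v) =>
    AssetSwap.label_in_of_foreign pref hloop hlive hsafe hnash hlabel hvw hl
  exact AssetSwap.isReuniclus_of_label hloop hconn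
    { height_lt := hh
      relay := fun _ _ huv hl => AssetSwap.exists_relay hlive hlabel huv hl
      occurs := fun v w hvw hl => (key v w hvw hl).1
      only := fun v w hvw hl => (key v w hvw hl).2 }
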